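/- Let $d\in\mathbb N$ and let $\omega:[0,+\infty)\to[0,+\infty)$ be a non-quasianalytic weight function, i.e. a continuous increasing (not necessarily strictly) function such that: $(\alpha)$ there is $L\ge 1$ with $\omega(2t)\le L(\omega(t)+1)$ for all $t\ge0$; $(\beta)$ $\int_1^{+\infty}\omega(t)t^{-2}\,dt<+\infty$; $(\gamma)$ there are $a\in\mathbb R$, $b>0$ with $\omega(t)\ge a+b\log(1+t)$ for all $t\ge0$; $(\delta)$ $t\mapsto\omega(e^t)$ is convex on $\mathbb R$. Write $\omega(x):=\omega(|x|)$ for $x\in\mathbb R^d$, where $|x|$ is the Euclidean norm, and $\hat u(\xi):=\int_{\mathbb R^d}u(x)e^{-i\langle x,\xi\rangle}\,dx$. Let $\mathcal S_\omega(\mathbb R^d)$ be the set of all $u\in L^1(\mathbb R^d)$ (complex valued) such that $u,\hat u\in C^\infty(\mathbb R^d)$ and, for every $\lambda>0$ and every $\alpha\in\mathbb N_0^d$, $$\sup_{x\in\mathbb R^d}e^{\lambda\omega(x)}|D^\alpha u(x)|<+\infty\quad\text{and}\quad\sup_{\xi\in\mathbb R^d}e^{\lambda\omega(\xi)}|D^\alpha\hat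 u(\xi)|<+\infty .$$ For $f\in\mathcal S_\omega(\mathbb R^d)$ let $$\operatorname{Wig}f(x,\xi):=\int_{\mathbb R^d}f\Big(x+\frac t2\Big)\overline{f\Big(x-\frac t2\Big)}e^{-i\langle\xi,t\rangle}\,dt,\qquad x,\xi\in\mathbb R^d .$$ For $p,q\in[1,+\infty]$ let $L^{p,q}(\mathbb R^{2d})$ be the space of measurable $F$ on $\mathbb R^{2d}$ with $$\|F\|_{L^{p,q}}:=\Big(\int_{\mathbb R^d}\Big(\int_{\mathbb R^d}|F(x,\xi)|^p\,dx\Big)^{q/p}d\xi\Big)^{1/q}<+\infty,$$ the $L^p$ or $L^q$ norm being replaced by the essential supremum if $p$ or $q$ is $\infty$. Let $|x|_\infty:=\max_j|x_j|$ and, for a function $g$ on $\mathbb R^d$, let $R_g:=\sup\{|x|_\infty:x\in\operatorname{supp}g\}\in[0,+\infty]$ (with $R_0:=0$). Then for every $f\in\mathcal S_\omega(\mathbb R^d)$ and all $p,q\in[1,+\infty]$, the functions $|\xi|_\infty^N\operatorname{Wig}f(x,\xi)$ and $|x|_\infty^N\operatorname{Wig}f(x,\xi)$ belong to $L^{p,q}(\mathbb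 R^{2d})$ for every $N\in\mathbb N_0$, and the following limits exist in $[0,+\infty]$ and satisfy $$\lim_{N\to+\infty}\big\||\xi|_\infty^N\operatorname{Wig}f(x,\xi)\big\|_{L^{p,q}}^{1/N}=R_{\hat f},\qquad \lim_{N\to+\infty}\big\||x|_\infty^N\operatorname{Wig}f(x,\xi)\big\|_{L^{p,q}}^{1/N}=R_f .$$ -/

import Mathlib

open MeasureTheory Set Filter Topology
open scoped ENNReal

noncomputable section

namespace WignerPW

/-- Euclidean space `ℝ^d`, with its Euclidean norm and Lebesgue measure. -/
abbrev Rn (d : ℕ) : Type := EuclideanSpace ℝ (Fin d)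

/-- The sup norm `|x|_∞ = max_j |x_j|` on `ℝ^d` (the norm of the function space `Fin d → ℝ`). -/
def supNorm {d : ℕ} (x : Rn d) : ℝ := ‖(WithLp.ofLp x : Fin d → ℝ)‖

/-- Non-quasianalytic weight functions `ω : [0, ∞) → [0, ∞)`. Only the values of `ω` on `[0, ∞)`
matter. -/
structure IsWeight (ω : ℝ → ℝ) : Prop where
  continuousOn : ContinuousOn ω (Ici 0)
  monotoneOn : MonotoneOn ω (Ici 0)
  nonneg : ∀ t, 0 ≤ t → 0 ≤ ω t
  alpha : ∃ L : ℝ, 1 ≤ L ∧ ∀ t, 0 ≤ t → ω (2 * t) ≤ L * (ω t + 1)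
  beta : IntegrableOn (fun t : ℝ => ω t / t ^ 2) (Ioi 1)
  gamma : ∃ a b : ℝ, 0 < b ∧ ∀ t, 0 ≤ t → a + b * Real.log (1 + t) ≤ ω t
  delta : ConvexOn ℝ univ (fun t : ℝ => ω (Real.exp t))

/-- The Fourier transform `û(ξ) = ∫ u(x) e^{-i⟨x,ξ⟩} dx`. -/
def fourier {d : ℕ} (u : Rn d → ℂ) (ξ : Rn d) : ℂ :=
  ∫ x : Rn d, u x * Complex.exp (-Complex.I * ((inner ℝ x ξ : ℝ) : ℂ))

/-- The iterated partial derivative `∂_{J 0} ⋯ ∂_{J (n-1)} u (x)`. For a smooth `u` mixed partial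
derivatives commute, so that, as `n` and `J` vary, these are exactly the derivatives `∂^α u` over
all multi-indices `α` (the factor `(-i)^|α|` in `D^α = (-i)^|α| ∂^α` has modulus one and plays no
role below, where only `|D^α u|` is used). -/
def partialDeriv {d n : ℕ} (J : Fin n → Fin d) (u : Rn d → ℂ) (x : Rn d) : ℂ :=
  iteratedFDeriv ℝ n u x (fun i => EuclideanSpace.single (J i) (1 : ℝ))

/-- `sup_x e^{λ ω(|x|)} |D^α u(x)| < ∞` for all `λ > 0` and all multi-indices `α`. -/
def HasWeightedDecay {d : ℕ} (ω : ℝ → ℝ) (u : Rn d → ℂ) : Prop :=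
  ∀ l : ℝ, 0 < l → ∀ (n : ℕ) (J : Fin n → Fin d),
    BddAbove (range fun x : Rn d => Real.exp (l * ω ‖x‖) * ‖partialDeriv J u x‖)

/-- Membership in the weighted Schwartz class `S_ω(ℝ^d)`: `u ∈ L¹`, both `u` and `û` are `C^∞`,
and all derivatives of `u` and of `û` decay faster than every `e^{-λ ω}`. -/
structure MemSomega {d : ℕ} (ω : ℝ → ℝ) (u : Rn d → ℂ) : Prop where
  integrable : Integrable u
  contDiff : ContDiff ℝ (⊤ : ℕ∞) u
  contDiff_fourier : ContDiff ℝ (⊤ : ℕ∞) (fourier u)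
  decay : HasWeightedDecay ω u
  decay_fourier : HasWeightedDecay ω (fourier u)

/-- The cross-Wigner transform
`Wig(u,v)(x,ξ) = ∫ u(x + t/2) conj(v(x - t/2)) e^{-i⟨ξ,t⟩} dt`. -/
def crossWig {d : ℕ} (u v : Rn d → ℂ) (x ξ : Rn d) : ℂ :=
  ∫ t : Rn d, u (x + (1 / 2 : ℝ) • t) * (starRingEnd ℂ) (v (x - (1 / 2 : ℝ) • t)) *
    Complex.exp (-Complex.I * ((inner ℝ ξ t : ℝ) : ℂ))

/-- The Wigner transform `Wig u = Wig(u,u)`. -/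
def Wig {d : ℕ} (u : Rn d → ℂ) (x ξ : Rn d) : ℂ := crossWig u u x ξ

/-- The mixed norm `‖F‖_{L^{p,q}}`, with values in `[0, ∞]`: the `L^p` norm in `x`, followed by
the `L^q` norm in `ξ` (essential suprema for the exponent `∞`). -/
def mixedNorm {d : ℕ} (p q : ℝ≥0∞) (F : Rn d → Rn d → ℂ) : ℝ≥0∞ :=
  eLpNorm (fun ξ : Rn d => eLpNorm (fun x : Rn d => F x ξ) p volume) q volume

/-- Membership in `L^{p,q}(ℝ^{2d})`. -/
def MemMixedLp {d : ℕ} (p q : ℝ≥0∞) (F : Rn d → Rn d → ℂ) : Prop :=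
  Measurable (Function.uncurry F) ∧ mixedNorm p q F < ∞

/-- The support radius `R_g = sup {|x|_∞ : x ∈ supp g}`, an element of `[0, ∞]`
(equal to `0` when `g = 0`). -/
def supportRadius {d : ℕ} (g : Rn d → ℂ) : ℝ≥0∞ :=
  ⨆ x ∈ tsupport g, ENNReal.ofReal (supNorm x)

end WignerPW

end

/-! For continuous `F` and a continuous weight `w ≥ 0` with all moments finite, `‖w^N F‖^{1/N}`
tends to the supremum of `w` over `{F ≠ 0}` (`tendsto_mixedNorm_pow_mul`): it is at most `S^N ‖F‖`
from above, and from below the norm over a small box where `w > r` and `|F| > δ` suffices.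
Everything else identifies that supremum.

For `|x|_∞`: if `Wig f (x, ξ) ≠ 0`, then `f` is nonzero at two points with midpoint `x`, so `|x|_∞ ≤
R_f`. Conversely, if `Wig f (x, ·)` vanishes, Fourier inversion gives `f (s) * conj (f (2x - s)) =
0` for all `s`, and `s = x` yields `f x = 0`.

For `|ξ|_∞`, `wignerKernel_duality` writes `Wig f (x, ξ)` as a constant times the kernel of `fourier
f` at `(ξ, -x)`, so the same argument applies to `fourier f`. Condition (γ) turns the weighted decay
into rapid decay, which makes all moments finite. -/

namespace WignerPW

open scoped NNReal

/-! ### Mixed norms and the growth rate of moments -/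

section MixedNorm

variable {d : ℕ} {p q : ℝ≥0∞}

lemma mixedNorm_le_mul {F G : Rn d → Rn d → ℂ} (c : ℝ≥0)
    (h : ∀ x ξ, ‖F x ξ‖ ≤ c * ‖G x ξ‖) : mixedNorm p q F ≤ c * mixedNorm p q G := by
  refine eLpNorm_le_mul_eLpNorm_of_ae_le_mul' (Eventually.of_forall fun ξ => ?_) q
  simp only [enorm_eq_self]
  refine eLpNorm_le_mul_eLpNorm_of_ae_le_mul' (Eventually.of_forall fun x => ?_) p
  rw [enorm_eq_nnnorm, enorm_eq_nnnorm]
  exact_mod_cast h x ξ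

lemma mixedNorm_lt_top_of_le_mul {F : Rn d → Rn d → ℂ} {A B : Rn d → ℝ}
    (hA : MemLp A p volume) (hB : MemLp B q volume)
    (h : ∀ x ξ, ‖F x ξ‖ ≤ ‖A x‖ * ‖B ξ‖) : mixedNorm p q F < ∞ := by
  set c : ℝ≥0 := (eLpNorm A p volume).toNNReal with hc
  have hc' : (c : ℝ≥0∞) = eLpNorm A p volume := ENNReal.coe_toNNReal hA.2.ne
  refine (eLpNorm_le_mul_eLpNorm_of_ae_le_mul' (c := c) (g := B)
    (Eventually.of_forall fun ξ => ?_) q).trans_lt (ENNReal.mul_lt_top (by simp) hB.2)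
  simp only [enorm_eq_self]
  rw [hc', mul_comm]
  refine eLpNorm_le_mul_eLpNorm_of_ae_le_mul' (c := ‖B ξ‖₊) (Eventually.of_forall fun x => ?_) p
  rw [enorm_eq_nnnorm, enorm_eq_nnnorm, mul_comm]
  exact_mod_cast h x ξ

lemma eLpNorm_indicator_const_ne_zero {E : Type*} [NormedAddCommGroup E] [MeasurableSpace E]
    [BorelSpace E] {μ : Measure E} [μ.IsOpenPosMeasure] {U : Set E} (hU : IsOpen U)
    (hne : U.Nonempty) (hp : p ≠ 0) {G : Type*} [TopologicalSpace G] [ENormedAddMonoid G] {c : G}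
    (hc : c ≠ 0) : eLpNorm (U.indicator fun _ => c) p μ ≠ 0 := by
  intro h
  rw [eLpNorm_eq_zero_iff
    (aestronglyMeasurable_const.indicator hU.measurableSet) hp] at h
  refine hU.measure_ne_zero μ hne (measure_mono_null (fun x hx => ?_) (ae_iff.1 h))
  simpa [hx] using hc

lemma mixedNorm_indicator_ne_zero (hp : p ≠ 0) (hq : q ≠ 0) {U V : Set (Rn d)} (hU : IsOpen U)
    (hV : IsOpen V) (hU' : U.Nonempty) (hV' : V.Nonempty) :
    mixedNorm p q (fun x ξ => (U ×ˢ V).indicator (fun _ => (1 : ℂ)) (x, ξ)) ≠ 0 := by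
  have h : (fun ξ : Rn d => eLpNorm (fun x : Rn d =>
      (U ×ˢ V).indicator (fun _ => (1 : ℂ)) (x, ξ)) p volume)
      = V.indicator fun _ => eLpNorm (U.indicator fun _ => (1 : ℂ)) p volume := by
    ext ξ
    by_cases hξ : ξ ∈ V
    · simp only [hξ, indicator_of_mem]
      congr 1
      ext x
      by_cases hx : x ∈ U <;> simp [hx, hξ]
    · simp [hξ, indicator]
  unfold mixedNorm
  rw [h]
  exact eLpNorm_indicator_const_ne_zero hV hV' hq
    (eLpNorm_indicator_const_ne_zero hU hU' hp one_ne_zero)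

lemma tendsto_ennreal_rpow_one_div {c : ℝ≥0∞} (h0 : c ≠ 0) (h1 : c ≠ ∞) :
    Tendsto (fun N : ℕ => c ^ (1 / (N : ℝ))) atTop (𝓝 1) := by
  lift c to ℝ≥0 using h1
  have h0' : c ≠ 0 := by simpa using h0
  have h : Tendsto (fun N : ℕ => c ^ (1 / (N : ℝ))) atTop (𝓝 (c ^ (0 : ℝ))) :=
    Tendsto.nnrpow tendsto_const_nhds tendsto_one_div_atTop_nhds_zero_nat (Or.inl h0')
  rw [NNReal.rpow_zero] at h
  simpa [ENNReal.coe_rpow_of_ne_zero h0'] using ENNReal.tendsto_coe.2 h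

lemma tendsto_ennreal_mul_rpow_one_div (a : ℝ≥0) {c : ℝ≥0∞} (h0 : c ≠ 0) (h1 : c ≠ ∞) :
    Tendsto (fun N : ℕ => ((a : ℝ≥0∞) ^ N * c) ^ (1 / (N : ℝ))) atTop (𝓝 a) := by
  have h := ENNReal.Tendsto.const_mul (a := (a : ℝ≥0∞)) (tendsto_ennreal_rpow_one_div h0 h1)
    (Or.inl one_ne_zero)
  rw [mul_one] at h
  refine h.congr' ?_
  filter_upwards [eventually_ne_atTop 0] with N hN
  rw [ENNReal.mul_rpow_of_nonneg _ _ (by positivity), ← ENNReal.rpow_natCast, ← ENNReal.rpow_mul,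
    mul_one_div_cancel (by exact_mod_cast hN), ENNReal.rpow_one]

/-- The growth rate of the moments of `F` with respect to a weight `w` is the supremum of `w` over
the set where `F` does not vanish. -/
theorem tendsto_mixedNorm_pow_mul (hp : p ≠ 0) (hq : q ≠ 0) {F : Rn d → Rn d → ℂ}
    {w : Rn d → Rn d → ℝ} (hF : Continuous (Function.uncurry F))
    (hw : Continuous (Function.uncurry w)) (hw0 : ∀ x ξ, 0 ≤ w x ξ)
    (hfin : ∀ N : ℕ, mixedNorm p q (fun x ξ => ((w x ξ ^ N : ℝ) : ℂ) * F x ξ) ≠ ∞) {S : ℝ≥0∞}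
    (hle : ∀ x ξ, F x ξ ≠ 0 → ENNReal.ofReal (w x ξ) ≤ S)
    (hlub : ∀ a < S, ∃ x ξ, F x ξ ≠ 0 ∧ a < ENNReal.ofReal (w x ξ)) :
    Tendsto (fun N : ℕ => mixedNorm p q (fun x ξ => ((w x ξ ^ N : ℝ) : ℂ) * F x ξ) ^ (1 / (N : ℝ)))
      atTop (𝓝 S) := by
  refine tendsto_order.2 ⟨fun a ha => ?_, fun b hb => ?_⟩
  · obtain ⟨x₀, ξ₀, hF₀, ha₀⟩ := hlub a ha
    lift a to ℝ≥0 using ha.ne_top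
    -- The lower bound has `N`-th roots tending to `r`, so `r` must lie strictly above `a`.
    obtain ⟨r, har, hr⟩ := ENNReal.lt_iff_exists_nnreal_btwn.1 ha₀
    have hr' : (r : ℝ) < w x₀ ξ₀ := by
      rwa [← ENNReal.ofReal_coe_nnreal, ENNReal.ofReal_lt_ofReal_iff_of_nonneg r.coe_nonneg] at hr
    have hr0 : 0 < r := lt_of_le_of_lt (zero_le (a := a)) (by exact_mod_cast har)
    set δ : ℝ≥0 := ‖F x₀ ξ₀‖₊ / 2 with hδ
    have hδ0 : 0 < δ := by
      have : 0 < ‖F x₀ ξ₀‖₊ := by simpa using hF₀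
      positivity
    have hopen : IsOpen {z : Rn d × Rn d | (r : ℝ) < Function.uncurry w z ∧
        (δ : ℝ) < ‖Function.uncurry F z‖} :=
      (isOpen_lt continuous_const hw).inter (isOpen_lt continuous_const hF.norm)
    have hδF : (δ : ℝ) < ‖F x₀ ξ₀‖ := by
      have : 0 < ‖F x₀ ξ₀‖ := by simpa using hF₀
      rw [hδ]; push_cast; linarith
    obtain ⟨U, V, hU, hV, hxU, hξV, hUV⟩ := isOpen_prod_iff.1 hopen x₀ ξ₀ ⟨hr', hδF⟩
    set K : Rn d → Rn d → ℂ := fun x ξ => (U ×ˢ V).indicator (fun _ => (1 : ℂ)) (x, ξ) with hK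
    have hK0 : mixedNorm p q K ≠ 0 := mixedNorm_indicator_ne_zero hp hq hU hV ⟨_, hxU⟩ ⟨_, hξV⟩
    have hbound : ∀ N : ℕ, ∀ x ξ,
        ‖K x ξ‖ ≤ ((r ^ N * δ)⁻¹ : ℝ≥0) * ‖((w x ξ ^ N : ℝ) : ℂ) * F x ξ‖ := by
      intro N x ξ
      by_cases hz : (x, ξ) ∈ U ×ˢ V
      · obtain ⟨h1, h2⟩ := hUV hz
        simp only [Function.uncurry] at h1 h2
        simp only [hK, indicator_of_mem hz, norm_one, norm_mul, Complex.norm_real, Real.norm_eq_abs,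
          abs_pow, abs_of_nonneg (hw0 x ξ)]
        push_cast
        rw [inv_mul_eq_div, one_le_div (by positivity)]
        have := hw0 x ξ
        gcongr
      · simp only [hK, indicator_of_notMem hz, norm_zero]
        positivity
    have hmul : ∀ N : ℕ, (r : ℝ≥0∞) ^ N * (δ * mixedNorm p q K) ≤
        mixedNorm p q (fun x ξ => ((w x ξ ^ N : ℝ) : ℂ) * F x ξ) := by
      intro N
      have h := mixedNorm_le_mul (p := p) (q := q) _ (hbound N)
      have hne : (r ^ N * δ : ℝ≥0) ≠ 0 := by positivity
      rw [ENNReal.coe_inv hne] at h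
      calc (r : ℝ≥0∞) ^ N * (δ * mixedNorm p q K)
          = ((r ^ N * δ : ℝ≥0) : ℝ≥0∞) * mixedNorm p q K := by push_cast; ring
        _ ≤ ((r ^ N * δ : ℝ≥0) : ℝ≥0∞) * (((r ^ N * δ : ℝ≥0) : ℝ≥0∞)⁻¹ *
            mixedNorm p q (fun x ξ => ((w x ξ ^ N : ℝ) : ℂ) * F x ξ)) := by gcongr
        _ = _ := by
          rw [← mul_assoc, ENNReal.mul_inv_cancel (by exact_mod_cast hne) ENNReal.coe_ne_top, one_mul]
    -- The box need not be bounded: finiteness comes from the zeroth moment.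
    have hKtop : (δ : ℝ≥0∞) * mixedNorm p q K ≠ ∞ := by
      have h := hmul 0
      rw [pow_zero, one_mul] at h
      exact ne_top_of_le_ne_top (hfin 0) h
    have hlim := tendsto_ennreal_mul_rpow_one_div r
      (mul_ne_zero (by exact_mod_cast hδ0.ne') hK0) hKtop
    filter_upwards [hlim.eventually_const_lt har] with N hN
    exact hN.trans_le (ENNReal.rpow_le_rpow (hmul N) (by positivity))
  · lift S to ℝ≥0 using hb.ne_top
    have h0 : mixedNorm p q F ≠ ∞ := by simpa using hfin 0
    -- The maximum with 1 keeps the constant nonzero, so that its `N`-th root tends to 1 even when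
    -- `F = 0`.
    have hmul : ∀ N : ℕ, mixedNorm p q (fun x ξ => ((w x ξ ^ N : ℝ) : ℂ) * F x ξ) ≤
        (S : ℝ≥0∞) ^ N * max 1 (mixedNorm p q F) := by
      intro N
      have h : mixedNorm p q (fun x ξ => ((w x ξ ^ N : ℝ) : ℂ) * F x ξ) ≤
          ((S ^ N : ℝ≥0) : ℝ≥0∞) * mixedNorm p q F := by
        refine mixedNorm_le_mul _ fun x ξ => ?_
        by_cases hz : F x ξ = 0
        · simp [hz]
        have hS : w x ξ ≤ S := by
          have := hle x ξ hz
          rwa [← ENNReal.ofReal_coe_nnreal, ENNReal.ofReal_le_ofReal_iff S.coe_nonneg] at this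
        simp only [norm_mul, Complex.norm_real, Real.norm_eq_abs, abs_pow, abs_of_nonneg (hw0 x ξ)]
        push_cast
        gcongr
        exact hw0 x ξ
      rw [ENNReal.coe_pow] at h
      exact h.trans (mul_le_mul_right (le_max_right _ _) _)
    have hlim := tendsto_ennreal_mul_rpow_one_div S (c := max 1 (mixedNorm p q F))
      (by simp) (by simp [h0])
    filter_upwards [hlim.eventually_lt_const hb] with N hN
    exact (ENNReal.rpow_le_rpow (hmul N) (by positivity)).trans_lt hN

end MixedNorm

end WignerPW

noncomputable section

namespace WignerPW

open Complex (I exp)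
open scoped FourierTransform ComplexConjugate

/-! ### Rapid decay and integrability -/

section Wigner

variable {d : ℕ}

/-- Decay faster than every power of `1 + ‖x‖`. -/
def RapidDecay (u : Rn d → ℂ) : Prop :=
  ∀ M : ℕ, ∃ C : ℝ, 0 ≤ C ∧ ∀ x, (1 + ‖x‖) ^ M * ‖u x‖ ≤ C

lemma HasWeightedDecay.rapidDecay {ω : ℝ → ℝ} (hω : IsWeight ω) {u : Rn d → ℂ}
    (hu : HasWeightedDecay ω u) : RapidDecay u := by
  intro M
  obtain ⟨a, b, hb, hab⟩ := hω.gamma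
  -- With `M + 1` in place of `M`, `l` is positive also for `M = 0`.
  set l : ℝ := (M + 1) / b with hl
  have hl0 : 0 < l := by positivity
  obtain ⟨C, hC⟩ := hu l hl0 0 Fin.elim0
  have key : ∀ x, (1 + ‖x‖) ^ M * ‖u x‖ ≤ Real.exp (-(l * a)) * C := by
    intro x
    have h1 : Real.exp (l * ω ‖x‖) * ‖u x‖ ≤ C := by
      simpa [partialDeriv] using hC (mem_range_self x)
    have h2 : (1 + ‖x‖) ^ M ≤ Real.exp (-(l * a)) * Real.exp (l * ω ‖x‖) := by
      have h3 : (1 + ‖x‖) ^ M ≤ (1 + ‖x‖) ^ (M + 1) :=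
        pow_le_pow_right₀ (by linarith [norm_nonneg x]) M.le_succ
      refine h3.trans ?_
      rw [← Real.exp_log (show (0 : ℝ) < 1 + ‖x‖ by positivity), ← Real.exp_nat_mul, ← Real.exp_add,
        Real.exp_le_exp]
      have h4 := mul_le_mul_of_nonneg_left (hab ‖x‖ (norm_nonneg x)) hl0.le
      have h5 : l * b = M + 1 := by rw [hl]; field_simp
      rw [mul_add, ← mul_assoc, h5] at h4
      push_cast
      linarith
    calc (1 + ‖x‖) ^ M * ‖u x‖ ≤ Real.exp (-(l * a)) * Real.exp (l * ω ‖x‖) * ‖u x‖ := by gcongr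
      _ ≤ _ := by rw [mul_assoc]; gcongr
  exact ⟨_, le_trans (by positivity) (key 0), key⟩

lemma integrable_one_add_norm_pow_inv :
    Integrable (fun x : Rn d => ((1 + ‖x‖) ^ (d + 1))⁻¹) := by
  have h := integrable_one_add_norm (E := Rn d) (μ := volume) (r := (d + 1 : ℕ)) (by simp)
  refine h.congr (Eventually.of_forall fun x => ?_)
  simp only
  rw [Real.rpow_neg (by positivity), Real.rpow_natCast]

lemma RapidDecay.integrable {u : Rn d → ℂ} (hu : RapidDecay u) (hc : Continuous u) :
    Integrable u := by
  obtain ⟨C, -, hC⟩ := hu (d + 1)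
  refine (integrable_one_add_norm_pow_inv.const_mul C).mono' hc.aestronglyMeasurable
    (Eventually.of_forall fun x => ?_)
  have h : 0 < (1 + ‖x‖) ^ (d + 1) := by positivity
  rw [← div_eq_mul_inv, le_div_iff₀ h, mul_comm]
  exact hC x

lemma memLp_one_add_norm_pow_inv {p : ℝ≥0∞} (hp : 1 ≤ p) (C : ℝ) :
    MemLp (fun x : Rn d => C * ((1 + ‖x‖) ^ (d + 1))⁻¹) p volume := by
  have hcont : Continuous (fun x : Rn d => ((1 + ‖x‖) ^ (d + 1))⁻¹) :=
    Continuous.inv₀ (by fun_prop) fun x => by positivity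
  have hle : ∀ x : Rn d, ((1 + ‖x‖) ^ (d + 1))⁻¹ ≤ 1 := fun x =>
    inv_le_one_of_one_le₀ (one_le_pow₀ (by linarith [norm_nonneg x]))
  refine MemLp.const_mul ?_ C
  rcases eq_or_ne p ∞ with rfl | hp'
  · refine memLp_top_of_bound hcont.aestronglyMeasurable 1 (Eventually.of_forall fun x => ?_)
    rw [Real.norm_of_nonneg (by positivity)]
    exact hle x
  · rw [← integrable_norm_rpow_iff hcont.aestronglyMeasurable (by positivity) hp']
    refine integrable_one_add_norm_pow_inv.mono'
      (hcont.norm.rpow_const fun _ => Or.inr ENNReal.toReal_nonneg).aestronglyMeasurable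
      (Eventually.of_forall fun x => ?_)
    rw [Real.norm_of_nonneg (by positivity), Real.norm_of_nonneg (by positivity)]
    calc _ ≤ (((1 + ‖x‖) ^ (d + 1))⁻¹) ^ (1 : ℝ) :=
          Real.rpow_le_rpow_of_exponent_ge (by positivity) (hle x)
            (by simpa using ENNReal.toReal_mono hp' hp)
      _ = _ := Real.rpow_one _

/-! ### The Wigner kernel: decay and continuity -/

/-- The Wigner transform written as a Fourier integral centred at the point `x`. -/
def wignerKernel (u : Rn d → ℂ) (x ξ : Rn d) : ℂ :=
  ∫ s : Rn d, u s * conj (u ((2 : ℝ) • x - s)) * exp (-2 * I * ((inner ℝ ξ (s - x) : ℝ) : ℂ))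

lemma norm_exp_I_mul_real (r : ℝ) : ‖exp (I * r)‖ = 1 := by
  rw [mul_comm]; exact Complex.norm_exp_ofReal_mul_I r

lemma norm_exp_neg_two_I_mul_real (r : ℝ) : ‖exp (-2 * I * (r : ℂ))‖ = 1 := by
  rw [show -2 * I * (r : ℂ) = I * ((-2 * r : ℝ) : ℂ) by push_cast; ring, norm_exp_I_mul_real]

/-- Substitute `s = x + t/2`; the Jacobian is `2^d`. -/
lemma Wig_eq_wignerKernel (u : Rn d → ℂ) (x ξ : Rn d) :
    Wig u x ξ = ((2 ^ d : ℝ) : ℂ) * wignerKernel u x ξ := by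
  set g : Rn d → ℂ := fun s =>
    u s * conj (u ((2 : ℝ) • x - s)) * exp (-2 * I * ((inner ℝ ξ (s - x) : ℝ) : ℂ)) with hg
  have h1 : Wig u x ξ = ∫ t : Rn d, g (x + (1 / 2 : ℝ) • t) := by
    unfold Wig crossWig
    congr 1
    ext t
    simp only [hg]
    rw [show (2 : ℝ) • x - (x + (1 / 2 : ℝ) • t) = x - (1 / 2 : ℝ) • t by module,
      add_sub_cancel_left, inner_smul_right]
    congr 2
    push_cast
    ring
  rw [h1, Measure.integral_comp_smul volume (fun t => g (x + t)) (1 / 2), integral_add_left_eq_self]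
  simp [wignerKernel, hg, Complex.real_smul]

/-- Since `x` is the midpoint of `s` and `2x - s`, one of them has norm at least `‖x‖`, and the
factor of `u` there absorbs the power. -/
lemma exists_wignerKernel_bound {u : Rn d → ℂ} (hc : Continuous u) (hu : RapidDecay u) (M : ℕ) :
    ∃ C : ℝ, 0 ≤ C ∧ ∀ x ξ, (1 + ‖x‖) ^ M * ‖wignerKernel u x ξ‖ ≤ C := by
  obtain ⟨C, hC0, hC⟩ := hu M
  have hi := (hu.integrable hc).norm
  refine ⟨C * ((∫ s, ‖u s‖) + ∫ s, ‖u s‖), by positivity, fun x ξ => ?_⟩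
  have hi' : Integrable fun s => ‖u ((2 : ℝ) • x - s)‖ := hi.comp_sub_left _
  have hb : ∀ s, (1 + ‖x‖) ^ M * (‖u s‖ * ‖u ((2 : ℝ) • x - s)‖) ≤
      C * (‖u s‖ + ‖u ((2 : ℝ) • x - s)‖) := by
    intro s
    have h1 := hC s
    have h2 := hC ((2 : ℝ) • x - s)
    have hx : 2 * ‖x‖ ≤ ‖s‖ + ‖(2 : ℝ) • x - s‖ := by
      calc 2 * ‖x‖ = ‖s + ((2 : ℝ) • x - s)‖ := by simp [norm_smul]
        _ ≤ _ := norm_add_le _ _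
    rcases le_total ‖x‖ ‖s‖ with h | h
    · calc (1 + ‖x‖) ^ M * (‖u s‖ * ‖u ((2 : ℝ) • x - s)‖)
          ≤ (1 + ‖s‖) ^ M * (‖u s‖ * ‖u ((2 : ℝ) • x - s)‖) := by gcongr
        _ = ((1 + ‖s‖) ^ M * ‖u s‖) * ‖u ((2 : ℝ) • x - s)‖ := by ring
        _ ≤ C * ‖u ((2 : ℝ) • x - s)‖ := by gcongr
        _ ≤ _ := by gcongr; linarith [norm_nonneg (u s)]
    · have h' : ‖x‖ ≤ ‖(2 : ℝ) • x - s‖ := by linarith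
      calc (1 + ‖x‖) ^ M * (‖u s‖ * ‖u ((2 : ℝ) • x - s)‖)
          ≤ (1 + ‖(2 : ℝ) • x - s‖) ^ M * (‖u s‖ * ‖u ((2 : ℝ) • x - s)‖) := by gcongr
        _ = ((1 + ‖(2 : ℝ) • x - s‖) ^ M * ‖u ((2 : ℝ) • x - s)‖) * ‖u s‖ := by ring
        _ ≤ C * ‖u s‖ := by gcongr
        _ ≤ _ := by gcongr; linarith [norm_nonneg (u ((2 : ℝ) • x - s))]
  have hsum : ∫ s, C * (‖u s‖ + ‖u ((2 : ℝ) • x - s)‖) = C * ((∫ s, ‖u s‖) + ∫ s, ‖u s‖) := by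
    rw [integral_const_mul, integral_add hi hi', integral_sub_left_eq_self (fun s => ‖u s‖)]
  rw [← hsum, wignerKernel,
    show (1 + ‖x‖) ^ M = ‖(((1 + ‖x‖) ^ M : ℝ) : ℂ)‖ by
      rw [Complex.norm_real, Real.norm_of_nonneg (by positivity)],
    ← norm_mul, ← integral_const_mul]
  refine norm_integral_le_of_norm_le ((hi.add hi').const_mul C) (Eventually.of_forall fun s => ?_)
  rw [norm_mul, norm_mul, norm_mul, Complex.norm_real, Real.norm_of_nonneg (by positivity),
    norm_exp_neg_two_I_mul_real, mul_one, RCLike.norm_conj]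
  exact hb s

lemma continuous_wignerKernel {u : Rn d → ℂ} (hc : Continuous u) (hu : RapidDecay u) :
    Continuous (Function.uncurry (wignerKernel u)) := by
  obtain ⟨C, hC0, hC⟩ := hu 0
  refine continuous_of_dominated (F := fun (z : Rn d × Rn d) (s : Rn d) =>
    u s * conj (u ((2 : ℝ) • z.1 - s)) * exp (-2 * I * ((inner ℝ z.2 (s - z.1) : ℝ) : ℂ)))
    (bound := fun s => C * ‖u s‖) (fun z => Continuous.aestronglyMeasurable ?_)
    (fun z => Eventually.of_forall fun s => ?_) ((hu.integrable hc).norm.const_mul C)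
    (Eventually.of_forall fun s => ?_)
  · have := Complex.continuous_conj
    fun_prop
  · rw [norm_mul, norm_mul, norm_exp_neg_two_I_mul_real, mul_one, RCLike.norm_conj, mul_comm]
    gcongr
    simpa using hC ((2 : ℝ) • z.1 - s)
  · have := Complex.continuous_conj
    fun_prop

/-! ### Fourier inversion and duality -/

lemma fourier_eq_fourierTransform (u : Rn d → ℂ) (ξ : Rn d) :
    𝓕 u ξ = fourier u ((2 * Real.pi) • ξ) := by
  rw [Real.fourier_eq', fourier]
  congr 1
  ext x
  rw [smul_eq_mul, mul_comm, inner_smul_right]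
  congr 2
  push_cast
  ring

lemma fourier_inversion {u : Rn d → ℂ} (hc : Continuous u) (hu : Integrable u)
    (hu' : Integrable (fourier u)) (y : Rn d) :
    u y = ((((2 * Real.pi) ^ d)⁻¹ : ℝ) : ℂ) *
      ∫ η : Rn d, fourier u η * exp (I * ((inner ℝ η y : ℝ) : ℂ)) := by
  have hF : Integrable (𝓕 u) := by
    have : 𝓕 u = fun ξ => fourier u ((2 * Real.pi) • ξ) := funext (fourier_eq_fourierTransform u)
    rw [this]
    exact hu'.comp_smul (by positivity)
  conv_lhs => rw [← hc.fourierInv_fourier_eq hu hF]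
  have h := Measure.integral_comp_smul (volume : Measure (Rn d))
    (fun η => fourier u η * exp (I * ((inner ℝ η y : ℝ) : ℂ))) (2 * Real.pi)
  rw [abs_of_nonneg (by positivity), finrank_euclideanSpace_fin, Complex.real_smul] at h
  rw [← h, Real.fourierInv_eq']
  congr 1
  ext v
  rw [fourier_eq_fourierTransform, smul_eq_mul, mul_comm, inner_smul_left]
  congr 2
  simp only [conj_trivial]
  push_cast
  ring

/-- Expand `u s` by Fourier inversion and exchange the integrals; after `s = 2x - r`, the integral
over `r` is the conjugate of `fourier u` at `2ξ - η`. -/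
lemma wignerKernel_duality {u : Rn d → ℂ} (hc : Continuous u) (hu : Integrable u)
    (hc' : Continuous (fourier u)) (hu' : Integrable (fourier u)) (x ξ : Rn d) :
    wignerKernel u x ξ =
      ((((2 * Real.pi) ^ d)⁻¹ : ℝ) : ℂ) * wignerKernel (fourier u) ξ (-x) := by
  set v := fourier u with hv
  have hconj := Complex.continuous_conj
  have hint : Integrable (Function.uncurry fun (s η : Rn d) =>
      v η * exp (I * ((inner ℝ η s : ℝ) : ℂ)) * conj (u ((2 : ℝ) • x - s)) *
        exp (-2 * I * ((inner ℝ ξ (s - x) : ℝ) : ℂ))) (volume.prod volume) := by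
    have h := (hu.comp_sub_left ((2 : ℝ) • x)).mul_prod hu'
    refine h.mono (Continuous.aestronglyMeasurable ?_) (Eventually.of_forall fun z => ?_)
    · simp only [Function.uncurry_def]
      fun_prop
    · simp only [Function.uncurry_def]
      rw [norm_mul, norm_mul, norm_mul, norm_mul, norm_exp_neg_two_I_mul_real, norm_exp_I_mul_real,
        RCLike.norm_conj]
      linarith
  have inner_eq : ∀ η, ∫ s : Rn d, v η * exp (I * ((inner ℝ η s : ℝ) : ℂ)) *
      conj (u ((2 : ℝ) • x - s)) * exp (-2 * I * ((inner ℝ ξ (s - x) : ℝ) : ℂ)) =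
      v η * conj (v ((2 : ℝ) • ξ - η)) * exp (-2 * I * ((inner ℝ (-x) (η - ξ) : ℝ) : ℂ)) := by
    intro η
    have h := integral_sub_left_eq_self (fun s : Rn d => v η * exp (I * ((inner ℝ η s : ℝ) : ℂ)) *
      conj (u ((2 : ℝ) • x - s)) * exp (-2 * I * ((inner ℝ ξ (s - x) : ℝ) : ℂ))) volume
      ((2 : ℝ) • x)
    rw [← h, hv, fourier, fourier, ← integral_conj, ← integral_const_mul, ← integral_mul_const]
    congr 1
    ext r
    rw [sub_sub_cancel, map_mul, ← Complex.exp_conj]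
    have e1 : exp (I * ((inner ℝ η ((2 : ℝ) • x - r) : ℝ) : ℂ)) *
        exp (-2 * I * ((inner ℝ ξ ((2 : ℝ) • x - r - x) : ℝ) : ℂ)) =
        exp (conj (-I * ((inner ℝ r ((2 : ℝ) • ξ - η) : ℝ) : ℂ))) *
        exp (-2 * I * ((inner ℝ (-x) (η - ξ) : ℝ) : ℂ)) := by
      rw [← Complex.exp_add, ← Complex.exp_add]
      congr 1
      simp only [map_mul, map_neg, Complex.conj_I, Complex.conj_ofReal, inner_sub_right,
        inner_smul_right, inner_neg_left, real_inner_comm ξ r, real_inner_comm η r,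
        real_inner_comm η x, real_inner_comm ξ x]
      push_cast
      ring
    linear_combination ((∫ x, u x * exp (-I * ((inner ℝ x η : ℝ) : ℂ))) * conj (u r)) * e1
  calc wignerKernel u x ξ
      = ∫ s : Rn d, ((((2 * Real.pi) ^ d)⁻¹ : ℝ) : ℂ) * ∫ η : Rn d,
          v η * exp (I * ((inner ℝ η s : ℝ) : ℂ)) * conj (u ((2 : ℝ) • x - s)) *
            exp (-2 * I * ((inner ℝ ξ (s - x) : ℝ) : ℂ)) := by
        rw [wignerKernel]
        congr 1
        ext s
        conv_lhs => rw [fourier_inversion hc hu hu' s]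
        rw [integral_mul_const, integral_mul_const]
        ring
    _ = _ := by
        rw [integral_const_mul, integral_integral_swap hint, wignerKernel]
        congr 2
        ext η
        exact inner_eq η

lemma eq_zero_of_fourier_eq_zero {g : Rn d → ℂ} (hc : Continuous g) (hg : Integrable g)
    (h : fourier g = 0) : g = 0 := by
  ext y
  rw [fourier_inversion hc hg (by rw [h]; exact integrable_zero _ _ _) y, h]
  simp

lemma eq_zero_of_wignerKernel_eq_zero {u : Rn d → ℂ} (hc : Continuous u) (hu : RapidDecay u)
    {x : Rn d} (h : ∀ ξ, wignerKernel u x ξ = 0) : u x = 0 := by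
  have hconj := Complex.continuous_conj
  set g : Rn d → ℂ := fun s => u s * conj (u ((2 : ℝ) • x - s)) with hg
  have hgc : Continuous g := by fun_prop
  obtain ⟨C, hC0, hC⟩ := hu 0
  have hgi : Integrable g := by
    refine ((hu.integrable hc).norm.const_mul C).mono' hgc.aestronglyMeasurable
      (Eventually.of_forall fun s => ?_)
    rw [norm_mul, RCLike.norm_conj, mul_comm]
    gcongr
    simpa using hC ((2 : ℝ) • x - s)
  have hF : fourier g = 0 := by
    ext ξ
    -- The kernel's phase carries a factor 2 and is centred at `x`: hence the halved frequency and
    -- the extra exponential.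
    have h1 : fourier g ξ = wignerKernel u x ((1 / 2 : ℝ) • ξ) *
        exp (-I * ((inner ℝ x ξ : ℝ) : ℂ)) := by
      rw [wignerKernel, ← integral_mul_const, fourier]
      congr 1
      ext s
      rw [mul_assoc (u s * _), ← Complex.exp_add]
      congr 2
      rw [inner_smul_left, inner_sub_right, real_inner_comm, real_inner_comm ξ x]
      simp only [conj_trivial]
      push_cast
      ring
    rw [h1, h, zero_mul, Pi.zero_apply]
  have := congrFun (eq_zero_of_fourier_eq_zero hgc hgi hF) x
  have h2 : (2 : ℝ) • x - x = x := by module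
  simpa [hg, h2] using this

lemma exists_ne_zero_of_wignerKernel_ne_zero {u : Rn d → ℂ} {x ξ : Rn d}
    (h : wignerKernel u x ξ ≠ 0) : ∃ s, u s ≠ 0 ∧ u ((2 : ℝ) • x - s) ≠ 0 := by
  by_contra! hs
  refine h ?_
  rw [wignerKernel, ← integral_zero (Rn d) ℂ]
  congr 1
  ext s
  by_cases h0 : u s = 0
  · simp [h0]
  · simp [hs s h0]

/-! ### Support radius and the nonvanishing set of the kernel -/

lemma continuous_supNorm : Continuous (supNorm : Rn d → ℝ) :=
  (PiLp.continuous_ofLp 2 _).norm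

lemma supNorm_nonneg (x : Rn d) : 0 ≤ supNorm x := norm_nonneg _

lemma supNorm_le_norm (x : Rn d) : supNorm x ≤ ‖x‖ :=
  (pi_norm_le_iff_of_nonneg (norm_nonneg x)).2 fun i => PiLp.norm_apply_le x i

lemma two_mul_supNorm_le (x s : Rn d) : 2 * supNorm x ≤ supNorm s + supNorm ((2 : ℝ) • x - s) := by
  calc 2 * supNorm x = ‖WithLp.ofLp s + WithLp.ofLp ((2 : ℝ) • x - s)‖ := by
        rw [← WithLp.ofLp_add, add_sub_cancel, WithLp.ofLp_smul, norm_smul]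
        simp [supNorm]
    _ ≤ _ := norm_add_le _ _

lemma le_supportRadius {u : Rn d → ℂ} {s : Rn d} (hs : u s ≠ 0) :
    ENNReal.ofReal (supNorm s) ≤ supportRadius u :=
  le_iSup₂ (f := fun x (_ : x ∈ tsupport u) => ENNReal.ofReal (supNorm x)) s
    (subset_tsupport u hs)

/-- Sublevel sets of the sup norm are closed, so taking the closure of `{u ≠ 0}` does not raise the
supremum. -/
lemma exists_lt_of_lt_supportRadius {u : Rn d → ℂ} {a : ℝ≥0∞} (ha : a < supportRadius u) :
    ∃ s, u s ≠ 0 ∧ a < ENNReal.ofReal (supNorm s) := by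
  by_contra! h
  refine ha.not_ge (iSup₂_le fun x hx => ?_)
  have hcl : IsClosed {x : Rn d | ENNReal.ofReal (supNorm x) ≤ a} :=
    isClosed_le (ENNReal.continuous_ofReal.comp continuous_supNorm) continuous_const
  exact closure_minimal (fun s hs => h s hs) hcl hx

lemma supNorm_le_supportRadius_of_wignerKernel_ne_zero {u : Rn d → ℂ} {x ξ : Rn d}
    (h : wignerKernel u x ξ ≠ 0) : ENNReal.ofReal (supNorm x) ≤ supportRadius u := by
  obtain ⟨s, hs, hs'⟩ := exists_ne_zero_of_wignerKernel_ne_zero h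
  have h2 := two_mul_supNorm_le x s
  rcases le_total (supNorm x) (supNorm s) with hle | hle
  · exact (ENNReal.ofReal_le_ofReal hle).trans (le_supportRadius hs)
  · exact (ENNReal.ofReal_le_ofReal (by linarith)).trans (le_supportRadius hs')

lemma exists_wignerKernel_ne_zero_of_lt_supportRadius {u : Rn d → ℂ} (hc : Continuous u)
    (hu : RapidDecay u) {a : ℝ≥0∞} (ha : a < supportRadius u) :
    ∃ x ξ, wignerKernel u x ξ ≠ 0 ∧ a < ENNReal.ofReal (supNorm x) := by
  obtain ⟨x, hx, hax⟩ := exists_lt_of_lt_supportRadius ha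
  by_contra! h
  exact hx (eq_zero_of_wignerKernel_eq_zero hc hu fun ξ => by
    by_contra h0
    exact (h x ξ h0).not_gt hax)

/-- Joint decay in both variables upgrades to finite mixed norms of all moments. -/
lemma memMixedLp_pow_mul {p q : ℝ≥0∞} (hp : 1 ≤ p) (hq : 1 ≤ q) {F : Rn d → Rn d → ℂ}
    {w : Rn d → Rn d → ℝ} (hF : Continuous (Function.uncurry F))
    (hw : Continuous (Function.uncurry w)) (hw0 : ∀ x ξ, 0 ≤ w x ξ)
    (hwle : ∀ x ξ, w x ξ ≤ (1 + ‖x‖) * (1 + ‖ξ‖))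
    (h1 : ∀ M : ℕ, ∃ C : ℝ, 0 ≤ C ∧ ∀ x ξ, (1 + ‖x‖) ^ M * ‖F x ξ‖ ≤ C)
    (h2 : ∀ M : ℕ, ∃ C : ℝ, 0 ≤ C ∧ ∀ x ξ, (1 + ‖ξ‖) ^ M * ‖F x ξ‖ ≤ C) (N : ℕ) :
    MemMixedLp p q (fun x ξ => ((w x ξ ^ N : ℝ) : ℂ) * F x ξ) := by
  refine ⟨Continuous.measurable ?_, ?_⟩
  · exact (Complex.continuous_ofReal.comp (hw.pow N)).mul hF
  -- The exponent is doubled for `ab ≤ a² + b²`, which turns decay in each variable separately into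
  -- joint decay.
  obtain ⟨A, hA0, hA⟩ := h1 (2 * (N + (d + 1)))
  obtain ⟨B, hB0, hB⟩ := h2 (2 * (N + (d + 1)))
  refine mixedNorm_lt_top_of_le_mul (memLp_one_add_norm_pow_inv hp (A + B))
    (memLp_one_add_norm_pow_inv hq 1) fun x ξ => ?_
  have ha : 0 < 1 + ‖x‖ := by positivity
  have hb : 0 < 1 + ‖ξ‖ := by positivity
  rw [norm_mul, Complex.norm_real, Real.norm_of_nonneg (pow_nonneg (hw0 x ξ) N),
    Real.norm_of_nonneg (by positivity), Real.norm_of_nonneg (by positivity), one_mul,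
    mul_assoc, ← mul_inv, ← div_eq_mul_inv, le_div_iff₀ (by positivity)]
  calc w x ξ ^ N * ‖F x ξ‖ * ((1 + ‖x‖) ^ (d + 1) * (1 + ‖ξ‖) ^ (d + 1))
      ≤ ((1 + ‖x‖) * (1 + ‖ξ‖)) ^ N * ‖F x ξ‖ * ((1 + ‖x‖) ^ (d + 1) * (1 + ‖ξ‖) ^ (d + 1)) := by
        have := hw0 x ξ
        have := hwle x ξ
        gcongr
    _ = ((1 + ‖x‖) ^ (N + (d + 1)) * (1 + ‖ξ‖) ^ (N + (d + 1))) * ‖F x ξ‖ := by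
        rw [mul_pow]; ring
    _ ≤ ((1 + ‖x‖) ^ (2 * (N + (d + 1))) + (1 + ‖ξ‖) ^ (2 * (N + (d + 1)))) * ‖F x ξ‖ := by
        gcongr
        rw [mul_comm 2, pow_mul, pow_mul]
        nlinarith [sq_nonneg ((1 + ‖x‖) ^ (N + (d + 1)) - (1 + ‖ξ‖) ^ (N + (d + 1))),
          sq_nonneg ((1 + ‖x‖) ^ (N + (d + 1))), sq_nonneg ((1 + ‖ξ‖) ^ (N + (d + 1)))]
    _ ≤ A + B := by rw [add_mul]; exact add_le_add (hA x ξ) (hB x ξ)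

end Wigner

end WignerPW

end

/-! ### The main theorem -/

theorem corollary3p11 (d : ℕ) (ω : ℝ → ℝ) (hω : WignerPW.IsWeight ω)
    (f : WignerPW.Rn d → ℂ) (hf : WignerPW.MemSomega ω f)
    (p q : ℝ≥0∞) (hp : 1 ≤ p) (hq : 1 ≤ q) :
    ((∀ N : ℕ, WignerPW.MemMixedLp p q
        (fun x ξ => ((WignerPW.supNorm ξ ^ N : ℝ) : ℂ) * WignerPW.Wig f x ξ)) ∧
      Tendsto (fun N : ℕ => WignerPW.mixedNorm p q
          (fun x ξ => ((WignerPW.supNorm ξ ^ N : ℝ) : ℂ) * WignerPW.Wig f x ξ) ^ (1 / (N : ℝ)))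
        atTop (𝓝 (WignerPW.supportRadius (WignerPW.fourier f)))) ∧
    ((∀ N : ℕ, WignerPW.MemMixedLp p q
        (fun x ξ => ((WignerPW.supNorm x ^ N : ℝ) : ℂ) * WignerPW.Wig f x ξ)) ∧
      Tendsto (fun N : ℕ => WignerPW.mixedNorm p q
          (fun x ξ => ((WignerPW.supNorm x ^ N : ℝ) : ℂ) * WignerPW.Wig f x ξ) ^ (1 / (N : ℝ)))
        atTop (𝓝 (WignerPW.supportRadius f))) := by
  open WignerPW in
  have hc : Continuous f := hf.contDiff.continuous
  have hc' : Continuous (fourier f) := hf.contDiff_fourier.continuous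
  have hr : RapidDecay f := hf.decay.rapidDecay hω
  have hr' : RapidDecay (fourier f) := hf.decay_fourier.rapidDecay hω
  have hp0 : p ≠ 0 := (zero_lt_one.trans_le hp).ne'
  have hq0 : q ≠ 0 := (zero_lt_one.trans_le hq).ne'
  set c : ℂ := ((2 ^ d : ℝ) : ℂ) with hcdef
  have hc0 : c ≠ 0 := by rw [hcdef]; exact_mod_cast (by positivity : (2 ^ d : ℝ) ≠ 0)
  set c' : ℂ := c * ((((2 * Real.pi) ^ d)⁻¹ : ℝ) : ℂ) with hcdef'
  have hc0' : c' ≠ 0 :=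
    mul_ne_zero hc0 (by exact_mod_cast (by positivity : (((2 * Real.pi) ^ d)⁻¹ : ℝ) ≠ 0))
  have hW : ∀ x ξ, Wig f x ξ = c * wignerKernel f x ξ := Wig_eq_wignerKernel f
  have hW' : ∀ x ξ, Wig f x ξ = c' * wignerKernel (fourier f) ξ (-x) := fun x ξ => by
    rw [hW, wignerKernel_duality hc hf.integrable hc' (hr'.integrable hc') x ξ, hcdef', mul_assoc]
  have hcont : Continuous (Function.uncurry (Wig f)) := by
    have h : Function.uncurry (Wig f) = fun z => c * Function.uncurry (wignerKernel f) z :=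
      funext fun z => hW z.1 z.2
    rw [h]
    exact continuous_const.mul (continuous_wignerKernel hc hr)
  have hd1 : ∀ M : ℕ, ∃ C : ℝ, 0 ≤ C ∧ ∀ x ξ, (1 + ‖x‖) ^ M * ‖Wig f x ξ‖ ≤ C := fun M => by
    obtain ⟨C, hC0, hC⟩ := exists_wignerKernel_bound hc hr M
    refine ⟨‖c‖ * C, by positivity, fun x ξ => ?_⟩
    rw [hW, norm_mul, mul_left_comm]
    exact mul_le_mul_of_nonneg_left (hC x ξ) (norm_nonneg _)
  have hd2 : ∀ M : ℕ, ∃ C : ℝ, 0 ≤ C ∧ ∀ x ξ, (1 + ‖ξ‖) ^ M * ‖Wig f x ξ‖ ≤ C := fun M => by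
    obtain ⟨C, hC0, hC⟩ := exists_wignerKernel_bound hc' hr' M
    refine ⟨‖c'‖ * C, by positivity, fun x ξ => ?_⟩
    rw [hW', norm_mul, mul_left_comm]
    exact mul_le_mul_of_nonneg_left (hC ξ (-x)) (norm_nonneg _)
  have hw2 : Continuous (Function.uncurry fun _ ξ : Rn d => supNorm ξ) :=
    continuous_supNorm.comp continuous_snd
  have hw1 : Continuous (Function.uncurry fun x _ : Rn d => supNorm x) :=
    continuous_supNorm.comp continuous_fst
  have hmem2 := memMixedLp_pow_mul hp hq hcont hw2 (fun _ ξ => supNorm_nonneg ξ)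
    (fun x ξ => by nlinarith [supNorm_le_norm ξ, norm_nonneg x, norm_nonneg ξ]) hd1 hd2
  have hmem1 := memMixedLp_pow_mul hp hq hcont hw1 (fun x _ => supNorm_nonneg x)
    (fun x ξ => by nlinarith [supNorm_le_norm x, norm_nonneg x, norm_nonneg ξ]) hd1 hd2
  refine ⟨⟨hmem2, tendsto_mixedNorm_pow_mul hp0 hq0 hcont hw2 (fun _ ξ => supNorm_nonneg ξ)
    (fun N => (hmem2 N).2.ne) (fun x ξ h => ?_) fun a ha => ?_⟩,
    ⟨hmem1, tendsto_mixedNorm_pow_mul hp0 hq0 hcont hw1 (fun x _ => supNorm_nonneg x)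
    (fun N => (hmem1 N).2.ne) (fun x ξ h => ?_) fun a ha => ?_⟩⟩
  · rw [hW'] at h
    exact supNorm_le_supportRadius_of_wignerKernel_ne_zero (right_ne_zero_of_mul h)
  · obtain ⟨ξ, x, h, hlt⟩ := exists_wignerKernel_ne_zero_of_lt_supportRadius hc' hr' ha
    -- The sign compensates for the `-x` in the duality formula.
    exact ⟨-x, ξ, by rw [hW', neg_neg]; exact mul_ne_zero hc0' h, hlt⟩
  · rw [hW] at h
    exact supNorm_le_supportRadius_of_wignerKernel_ne_zero (right_ne_zero_of_mul h)
  · obtain ⟨x, ξ, h, hlt⟩ := exists_wignerKernel_ne_zero_of_lt_supportRadius hc hr ha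
    exact ⟨x, ξ, by rw [hW]; exact mul_ne_zero hc0 h, hlt⟩
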